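/- Let $A$ be a real primitive matrix of order $n\ge 1$ (nonnegative, with some power $A^m$, $m\ge1$, entrywise positive). Write $\rho=\lambda_1$ for its spectral radius (the Perron root), $\lambda_2,\dots,\lambda_n$ for its other complex eigenvalues, counted with algebraic multiplicity, $|\lambda_2|$ for the largest modulus among these (with $|\lambda_2|=0$ if $n=1$), and $s$ for the largest size of a Jordan block of $A$ belonging to one of $\lambda_2,\dots,\lambda_n$ of modulus $|\lambda_2|$. Write $r_i(M)=\sum_j m_{ij}$ for the row sums of a matrix $M$. The algorithm, in its two forms (without the stopping test): (A) $A^{(0)}=A$ and $a^{(t+1)}_{ij}=\dfrac{r_j(A^{(t)})}{r_i(A^{(t)})}\,a^{(t)}_{ij}$. (B) $B^{(0)}=A$, $\mathbf y^{(0)}=\mathbf 1$, $\;y^{(t+1)}_i=y^{(t)}_i\,\dfrac{r_i(B^{(t)})}{r_1(B^{(t)})}\;$ and $\;b^{(t+1)}_{ij}=a_{ij}\,y^{(t+1)}_j/y^{(t+1)}_i$. Then: 1. $\rho>0$ and $|\lambda_2|<\rho$. 2. All row sums $r_i(A^{(k)})$ are positive, so every step is well defined, and $B^{(k)}=A^{(k)}$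 for all $k$. 3. For every $k$, $\operatorname{span}(\mathbf y^{(k)})=\operatorname{span}(\mathbf q^{(k)})$, where $\mathbf q^{(0)}=\mathbf 1$, $\mathbf q^{(k+1)}=A\mathbf q^{(k)}/\|A\mathbf q^{(k)}\|_2$ are the iterates of the power method started at $\mathbf 1$. 4. There is an entrywise positive vector $\mathbf u$ with $A\mathbf u=\rho\mathbf u$ and $\sum_i u_i=1$ (the Perron vector), and every real vector $\mathbf w$ with $A\mathbf w=\rho\mathbf w$ is a multiple of $\mathbf u$. As $k\to\infty$, $$\operatorname{dist}\bigl(\operatorname{span}(\mathbf y^{(k)}),\operatorname{span}(\mathbf u)\bigr)=O\!\left(k^{\max(s-1,0)}\left|\frac{\lambda_2}{\lambda_1}\right|^k\right),\qquad r_i(A^{(k)})-\rho=O\!\left(k^{\max(s-1,0)}\left|\frac{\lambda_2}{\lambda_1}\right|^k\right)\quad(1\le i\le n).$$ 5. If $A$ is diagonalizable over $\mathbb C$, that is $A=U\Lambda U^{-1}$ with $\Lambda$ diagonal, then, as $k\to\infty$, $$\operatorname{dist}\bigl(\operatorname{span}(\mathbf y^{(k)}),\operatorname{span}(\mathbf u)\bigr)=O\!\left(\left|\frac{\lambda_2}{\lambda_1}\right|^k\right),\qquad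 r_i(A^{(k)})-\rho=O\!\left(\left|\frac{\lambda_2}{\lambda_1}\right|^k\right)\quad(1\le i\le n).$$ Here $\operatorname{dist}(S,T)=\|P_S-P_T\|_2$, with $P_S$, $P_T$ the orthogonal projections onto the subspaces $S$, $T$ of $\mathbb R^n$. -/

import Mathlib

open Filter Asymptotics

noncomputable section

namespace MincIteration

variable {n : ℕ}

/-- The vector of row sums `r_i(A) = ∑ j, a_{ij}`. -/
def rowSums (A : Matrix (Fin n) (Fin n) ℝ) : Fin n → ℝ :=
  fun i => ∑ j, A i j

/-- The matrices produced by the row-sum algorithm (Perron root only): `A^(0) = A` and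
`a_{ij}^(t+1) = (r_j(A^(t)) / r_i(A^(t))) a_{ij}^(t)`. -/
def rowIterate (A : Matrix (Fin n) (Fin n) ℝ) : ℕ → Matrix (Fin n) (Fin n) ℝ
  | 0 => A
  | t + 1 => Matrix.of fun i j =>
      rowSums (rowIterate A t) j / rowSums (rowIterate A t) i * rowIterate A t i j

/-- The pairs `(B, y)` produced by the row-sum algorithm that also computes the Perron vector:
it starts at `(A, 1)`, and one step replaces `y` by `y ∘ y^(t)`, where
`y^(t) = (1, r_2(B)/r_1(B), …, r_n(B)/r_1(B))`, and then `B` by `A ∘ (x yᵀ)` with `x = 1/y`. -/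
def vectorIterate [NeZero n] (A : Matrix (Fin n) (Fin n) ℝ) :
    ℕ → Matrix (Fin n) (Fin n) ℝ × (Fin n → ℝ)
  | 0 => (A, fun _ => 1)
  | t + 1 =>
      let B := (vectorIterate A t).1
      let y : Fin n → ℝ := fun i => (vectorIterate A t).2 i * (rowSums B i / rowSums B 0)
      (Matrix.hadamard A (Matrix.vecMulVec (fun i => (y i)⁻¹) y), y)

/-- The power method started at the all-ones vector: `q_0 = 1` and
`q_{k+1} = A q_k / ‖A q_k‖₂`. -/
def powerIterate (A : Matrix (Fin n) (Fin n) ℝ) : ℕ → (Fin n → ℝ)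
  | 0 => fun _ => 1
  | k + 1 => ‖WithLp.toLp 2 (A.mulVec (powerIterate A k))‖⁻¹ • A.mulVec (powerIterate A k)

/-- A real matrix, viewed as a complex one. -/
def toComplex (A : Matrix (Fin n) (Fin n) ℝ) : Matrix (Fin n) (Fin n) ℂ :=
  A.map Complex.ofReal

/-- The spectral radius `ρ(A)`, as a real number. -/
def perronRoot (A : Matrix (Fin n) (Fin n) ℝ) : ℝ :=
  (spectralRadius ℂ (toComplex A)).toReal

/-- The eigenvalues `λ_2, …, λ_n`: the complex eigenvalues of `A`, listed with algebraic
multiplicity, with one copy of `λ_1 = ρ(A)` removed. -/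
def otherEigenvalues (A : Matrix (Fin n) (Fin n) ℝ) : Multiset ℂ :=
  (toComplex A).charpoly.roots.erase (perronRoot A : ℂ)

/-- `|λ_2|`: the largest modulus of the eigenvalues `λ_2, …, λ_n` (`0` if `n = 1`). -/
def secondModulus (A : Matrix (Fin n) (Fin n) ℝ) : ℝ :=
  (((otherEigenvalues A).map fun μ => ‖μ‖₊).sup : NNReal)

/-- The largest size of a Jordan block of `A` that belongs to an eigenvalue of modulus `|λ_2|`
among `λ_2, …, λ_n` (`0` if `n = 1`). The size of the largest Jordan block at `μ` is the least `m`
for which `ker (A - μ)^m` is the whole generalized eigenspace. -/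
def secondJordanSize (A : Matrix (Fin n) (Fin n) ℝ) : ℕ :=
  (((otherEigenvalues A).filter fun μ => ‖μ‖ = secondModulus A).map fun μ =>
    Module.End.maxGenEigenspaceIndex (Matrix.toLin' (toComplex A)) μ).sup

/-- `A = U Λ U⁻¹` with `U` invertible and `Λ` diagonal, over the complex numbers. -/
def IsDiagonalizable (A : Matrix (Fin n) (Fin n) ℝ) : Prop :=
  ∃ (U : Matrix (Fin n) (Fin n) ℂ) (d : Fin n → ℂ),
    IsUnit U.det ∧ toComplex A = U * Matrix.diagonal d * U⁻¹

/-- `u` is the Perron vector of `A`: positive, an eigenvector for `ρ(A)`, with sum `1`. -/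
def IsPerronVector (A : Matrix (Fin n) (Fin n) ℝ) (u : Fin n → ℝ) : Prop :=
  (∀ i, 0 < u i) ∧ A.mulVec u = perronRoot A • u ∧ ∑ i, u i = 1

/-- The subspace of Euclidean space spanned by a vector. -/
def direction (x : Fin n → ℝ) : Submodule ℝ (EuclideanSpace ℝ (Fin n)) :=
  Submodule.span ℝ {WithLp.toLp 2 x}

/-- The distance between two subspaces: the operator norm, for the Euclidean norm, of the
difference of the orthogonal projections onto them. -/
def subspaceDist (S T : Submodule ℝ (EuclideanSpace ℝ (Fin n))) : ℝ :=
  ‖S.starProjection - T.starProjection‖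

end MincIteration

end

namespace MincIteration

variable {n : ℕ}

/-! Both forms of the algorithm are the power method in disguise: the current matrix is always `D⁻¹
A D` with `D = diag(A ^ k 1)`. Hence its `i`-th row sum is `(A ^ (k+1) 1)_i / (A ^ k 1)_i`, and `y`
is `A ^ k 1` scaled to have first entry `1` (`rowIterate_eq`, `vectorIterate_eq`). Everything
reduces to the asymptotics of `A ^ k 1`.

Split `ℂⁿ` into generalized eigenspaces. The one at `ρ` is the line of the Perron vector `u`
(`maxGenEigenspace_perronRoot`), and the component along it is read off by a positive left
eigenvector `w` with `w ⬝ᵥ u = 1`. On the others `A ^ k v` is a polynomial in `k` times an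
exponential, the degree bounded through the Jordan block size. So `ρ⁻ᵏ A ^ k 1 = (w ⬝ᵥ 1) u +
O(rate)` with `w ⬝ᵥ 1 > 0`. The distance between lines is controlled by that between spanning
vectors, and the row sum error is `((A - ρ) x)_i / x_i`, where `A - ρ` kills `u`.

The Perron–Frobenius facts rest on one principle: no positive `x` has `A x > ρ x` in every
coordinate, since `A ^ k x` would then outgrow what the spectral radius allows. -/

/-! ### Growth of powers on a generalized eigenspace -/

theorem isBigO_pow_apply_of_mem_maxGenEigenspace {V : Type*} [NormedAddCommGroup V]
    [NormedSpace ℂ V] [FiniteDimensional ℂ V] (f : Module.End ℂ V) (μ : ℂ) {v : V}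
    (hv : v ∈ f.maxGenEigenspace μ) :
    (fun k : ℕ => (f ^ k) v) =O[atTop]
      fun k : ℕ => (k : ℝ) ^ (f.maxGenEigenspaceIndex μ - 1) * ‖μ‖ ^ k := by
  set m := f.maxGenEigenspaceIndex μ with hm
  have hv' : ((f - algebraMap ℂ _ μ) ^ m) v = 0 := by
    rw [Module.End.maxGenEigenspace_eq, Module.End.mem_genEigenspace_nat,
      LinearMap.mem_ker] at hv
    exact hv
  set N := f - algebraMap ℂ _ μ with hN
  have hzero : ∀ j, m ≤ j → (N ^ j) v = 0 := fun j hj => by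
    obtain ⟨i, rfl⟩ := Nat.exists_eq_add_of_le hj
    rw [add_comm, pow_add, Module.End.mul_apply, hv', map_zero]
  -- Binomial expansion of `(N + μ) ^ k`, cut off at `j < m` because `N ^ m` kills `v`.
  have hexp : ∀ k, m ≤ k → (f ^ k) v =
      ∑ j ∈ Finset.range m, ((k.choose j : ℂ) * μ ^ (k - j)) • (N ^ j) v := by
    intro k hk
    have hf : f = N + algebraMap ℂ _ μ := by simp [hN]
    have hc : Commute N (algebraMap ℂ (Module.End ℂ V) μ) := Algebra.commute_algebraMap_right _ _
    conv_lhs => rw [hf, hc.add_pow]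
    rw [LinearMap.sum_apply, ← Finset.sum_subset (Finset.range_mono (show m ≤ k + 1 by omega))]
    · refine Finset.sum_congr rfl fun j _ => ?_
      rw [← map_pow, ← nsmul_eq_mul', LinearMap.smul_apply, (Algebra.commutes _ _).symm,
        Module.End.mul_apply, Module.algebraMap_end_apply, ← Nat.cast_smul_eq_nsmul ℂ, smul_smul]
    · intro j _ hj
      rw [← map_pow, ← nsmul_eq_mul', LinearMap.smul_apply, (Algebra.commutes _ _).symm,
        Module.End.mul_apply, hzero j (by simpa using hj), map_zero, smul_zero]
  have hsum : (fun k : ℕ => ∑ j ∈ Finset.range m, ((k.choose j : ℂ) * μ ^ (k - j)) • (N ^ j) v)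
      =O[atTop] fun k : ℕ => (k : ℝ) ^ (m - 1) * ‖μ‖ ^ k := by
    refine IsBigO.fun_sum fun j hj => ?_
    rw [Finset.mem_range] at hj
    refine IsBigO.of_bound (‖(N ^ j) v‖ * (‖μ‖ ^ j)⁻¹) ?_
    filter_upwards [eventually_ge_atTop m, eventually_ge_atTop 1] with k hk hk1
    have hk1' : (1 : ℝ) ≤ k := by exact_mod_cast hk1
    have h1 : (k.choose j : ℝ) ≤ (k : ℝ) ^ (m - 1) :=
      (by exact_mod_cast Nat.choose_le_pow k j : (k.choose j : ℝ) ≤ (k : ℝ) ^ j).trans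
        (pow_le_pow_right₀ hk1' (by omega))
    -- For `μ = 0` the left side vanishes because `j < m ≤ k`.
    have h2 : ‖μ‖ ^ (k - j) ≤ (‖μ‖ ^ j)⁻¹ * ‖μ‖ ^ k := by
      rcases eq_or_ne μ 0 with rfl | hμ
      · rw [norm_zero, zero_pow (by omega : k - j ≠ 0)]
        positivity
      · rw [pow_sub₀ _ (norm_ne_zero_iff.2 hμ) (by omega), mul_comm]
    rw [norm_smul, norm_mul, norm_pow, Complex.norm_natCast, norm_mul, norm_pow, norm_pow,
      norm_norm, Real.norm_of_nonneg (Nat.cast_nonneg k)]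
    calc (k.choose j : ℝ) * ‖μ‖ ^ (k - j) * ‖(N ^ j) v‖
        ≤ (k : ℝ) ^ (m - 1) * ((‖μ‖ ^ j)⁻¹ * ‖μ‖ ^ k) * ‖(N ^ j) v‖ := by gcongr
      _ = _ := by ring
  refine hsum.congr' ?_ EventuallyEq.rfl
  filter_upwards [eventually_ge_atTop m] with k hk using (hexp k hk).symm

/-! ### Perron–Frobenius theory of a primitive matrix -/

theorem toComplex_mulVec_ofReal (A : Matrix (Fin n) (Fin n) ℝ) (x : Fin n → ℝ) :
    (toComplex A).mulVec (fun i => (x i : ℂ)) = fun i => ((A.mulVec x i : ℝ) : ℂ) := by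
  ext i
  simp [toComplex, Matrix.mulVec, dotProduct]

theorem toComplex_pow (A : Matrix (Fin n) (Fin n) ℝ) (k : ℕ) :
    toComplex (A ^ k) = toComplex A ^ k :=
  Matrix.map_pow A Complex.ofRealHom k

theorem norm_toComplex_mulVec_le {A : Matrix (Fin n) (Fin n) ℝ} (hA : ∀ i j, 0 ≤ A i j)
    (z : Fin n → ℂ) (i : Fin n) :
    ‖(toComplex A).mulVec z i‖ ≤ A.mulVec (fun j => ‖z j‖) i := by
  simp only [toComplex, Matrix.mulVec, dotProduct, Matrix.map_apply]
  refine (norm_sum_le _ _).trans (Finset.sum_le_sum fun j _ => ?_)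
  rw [norm_mul, Complex.norm_real, Real.norm_of_nonneg (hA i j)]

theorem exists_norm_eq_perronRoot [NeZero n] (A : Matrix (Fin n) (Fin n) ℝ) :
    ∃ μ ∈ spectrum ℂ (toComplex A), ‖μ‖ = perronRoot A ∧
      ∀ ν ∈ spectrum ℂ (toComplex A), ‖ν‖ ≤ ‖μ‖ := by
  obtain ⟨μ, hμ, hmax⟩ := Set.exists_max_image (spectrum ℂ (toComplex A)) (fun ν => ‖ν‖₊)
    (Matrix.finite_spectrum _)
    (spectrum.nonempty_of_isAlgClosed_of_finiteDimensional ℂ (toComplex A))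
  refine ⟨μ, hμ, ?_, hmax⟩
  have h : spectralRadius ℂ (toComplex A) = (‖μ‖₊ : ENNReal) :=
    le_antisymm (iSup₂_le fun ν hν => ENNReal.coe_le_coe.2 (hmax ν hν))
      (le_iSup₂ (f := fun (ν : ℂ) (_ : ν ∈ spectrum ℂ (toComplex A)) => (‖ν‖₊ : ENNReal)) μ hμ)
  rw [perronRoot, h, ENNReal.coe_toReal, coe_nnnorm]

theorem norm_le_perronRoot [NeZero n] (A : Matrix (Fin n) (Fin n) ℝ) {μ : ℂ}
    (hμ : μ ∈ spectrum ℂ (toComplex A)) : ‖μ‖ ≤ perronRoot A := by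
  obtain ⟨ν, -, hν, hmax⟩ := exists_norm_eq_perronRoot A
  exact hν ▸ hmax μ hμ

theorem exists_eigenvector {A : Matrix (Fin n) (Fin n) ℝ} {μ : ℂ}
    (hμ : μ ∈ spectrum ℂ (toComplex A)) :
    ∃ z : Fin n → ℂ, z ≠ 0 ∧ (toComplex A).mulVec z = μ • z := by
  rw [← Matrix.spectrum_toLin', ← Module.End.hasEigenvalue_iff_mem_spectrum] at hμ
  obtain ⟨z, hz⟩ := hμ.exists_hasEigenvector
  exact ⟨z, hz.2, by simpa using hz.apply_eq_smul⟩

theorem mem_spectrum_of_mem_maxGenEigenspace {A : Matrix (Fin n) (Fin n) ℝ} {μ : ℂ}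
    {v : Fin n → ℂ} (hv : v ∈ Module.End.maxGenEigenspace (Matrix.toLin' (toComplex A)) μ) (hv0 : v ≠ 0) :
    μ ∈ spectrum ℂ (toComplex A) := by
  rw [← Matrix.spectrum_toLin', ← Module.End.hasEigenvalue_iff_mem_spectrum]
  rw [Module.End.maxGenEigenspace_eq] at hv
  refine Module.End.hasEigenvalue_of_hasGenEigenvalue
    (k := Module.End.maxGenEigenspaceIndex (Matrix.toLin' (toComplex A)) μ) ?_
  exact fun h => hv0 (by simpa [h] using hv)

theorem toLin'_pow_apply (M : Matrix (Fin n) (Fin n) ℂ) (k : ℕ) (v : Fin n → ℂ) :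
    (Matrix.toLin' M ^ k) v = (M ^ k).mulVec v := by
  rw [← Matrix.toLin'_pow, Matrix.toLin'_apply]

/-- The strict inequality `ρ < r` leaves room to absorb the polynomial factors of the Jordan blocks.
-/
theorem isBigO_toComplex_pow_mulVec [NeZero n] (A : Matrix (Fin n) (Fin n) ℝ) {r : ℝ}
    (hr : perronRoot A < r) (v : Fin n → ℂ) :
    (fun k : ℕ => (toComplex A ^ k).mulVec v) =O[atTop] fun k : ℕ => r ^ k := by
  have hv : v ∈ ⨆ μ, Module.End.maxGenEigenspace (Matrix.toLin' (toComplex A)) μ := by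
    rw [Module.End.iSup_maxGenEigenspace_eq_top]; trivial
  induction hv using Submodule.iSup_induction' with
  | mem μ v hv =>
    rcases eq_or_ne v 0 with rfl | hv0
    · simpa using isBigO_zero _ _
    · have hμ := norm_le_perronRoot A (mem_spectrum_of_mem_maxGenEigenspace hv hv0)
      have h1 := isBigO_pow_apply_of_mem_maxGenEigenspace _ μ hv
      simp only [toLin'_pow_apply] at h1
      refine h1.trans (IsLittleO.isBigO ?_)
      have h2 : ‖(‖μ‖ : ℝ)‖ < r := by rw [norm_norm]; exact hμ.trans_lt hr
      exact isLittleO_pow_const_mul_const_pow_const_pow_of_norm_lt _ h2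
  | zero => simpa using isBigO_zero _ _
  | add x y _ _ hx hy => simpa only [Matrix.mulVec_add] using hx.add hy

theorem isBigO_pow_mulVec [NeZero n] (A : Matrix (Fin n) (Fin n) ℝ) (x : Fin n → ℝ) {r : ℝ}
    (hr : perronRoot A < r) (i : Fin n) :
    (fun k : ℕ => (A ^ k).mulVec x i) =O[atTop] fun k : ℕ => r ^ k := by
  refine IsBigO.trans (IsBigO.of_bound 1 (Eventually.of_forall fun k => ?_))
    (isBigO_toComplex_pow_mulVec A hr fun i => (x i : ℂ))
  rw [← toComplex_pow, toComplex_mulVec_ofReal, one_mul]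
  simpa using norm_le_pi_norm (fun i => (((A ^ k).mulVec x i : ℝ) : ℂ)) i

theorem pow_mul_le_pow_mulVec {A : Matrix (Fin n) (Fin n) ℝ} (hA : ∀ i j, 0 ≤ A i j)
    {x : Fin n → ℝ} {r : ℝ} (hr : 0 ≤ r) (hx : ∀ i, r * x i ≤ A.mulVec x i) (k : ℕ) (i : Fin n) :
    r ^ k * x i ≤ (A ^ k).mulVec x i := by
  induction k generalizing i with
  | zero => simp
  | succ k ih =>
    rw [pow_succ', pow_succ', ← Matrix.mulVec_mulVec]
    calc r * r ^ k * x i = r ^ k * (r * x i) := by ring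
      _ ≤ r ^ k * A.mulVec x i := by gcongr; exact hx i
      _ = ∑ j, A i j * (r ^ k * x j) := by
        simp only [Matrix.mulVec, dotProduct, Finset.mul_sum]
        exact Finset.sum_congr rfl fun j _ => by ring
      _ ≤ _ := Finset.sum_le_sum fun j _ => mul_le_mul_of_nonneg_left (ih j) (hA i j)

theorem perronRoot_nonneg (A : Matrix (Fin n) (Fin n) ℝ) : 0 ≤ perronRoot A :=
  ENNReal.toReal_nonneg

/-- Otherwise the least ratio `r = (A x)_i / x_i` exceeds `ρ`, and `A ^ k x ≥ r ^ k x` contradicts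
the bound `O(s ^ k)` for any `s` strictly between. -/
theorem exists_mulVec_le_perronRoot_mul [NeZero n] {A : Matrix (Fin n) (Fin n) ℝ}
    (hA : ∀ i j, 0 ≤ A i j) {x : Fin n → ℝ} (hx : ∀ i, 0 < x i) :
    ∃ i, A.mulVec x i ≤ perronRoot A * x i := by
  by_contra! h
  obtain ⟨i, hi⟩ := Finite.exists_min fun i => A.mulVec x i / x i
  set r := A.mulVec x i / x i
  have hr : perronRoot A < r := (lt_div_iff₀ (hx i)).2 (h i)
  obtain ⟨s, hs, hsr⟩ := exists_between hr
  have hs0 : 0 ≤ s := (perronRoot_nonneg A).trans hs.le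
  have h1 : ∀ k, r ^ k * x i ≤ (A ^ k).mulVec x i := fun k =>
    pow_mul_le_pow_mulVec hA (hs0.trans hsr.le) (fun j => (le_div_iff₀ (hx j)).1 (hi j)) k i
  have h2 : (fun k : ℕ => r ^ k) =O[atTop] fun k : ℕ => s ^ k := by
    refine IsBigO.trans (IsBigO.of_bound (x i)⁻¹ (Eventually.of_forall fun k => ?_))
      (isBigO_pow_mulVec A x hs i)
    have h0 : 0 ≤ r ^ k := pow_nonneg (hs0.trans hsr.le) k
    rw [Real.norm_of_nonneg h0, inv_mul_eq_div, le_div_iff₀ (hx i)]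
    exact (h1 k).trans (le_abs_self _)
  refine isLittleO_irrefl (Eventually.frequently (Eventually.of_forall fun k => ?_))
    (h2.trans_isLittleO (isLittleO_pow_pow_of_lt_left hs0 hsr))
  exact pow_ne_zero k (hs0.trans_lt hsr).ne'

theorem mulVec_pos_of_pos {B : Matrix (Fin n) (Fin n) ℝ} (hB : ∀ i j, 0 < B i j) {x : Fin n → ℝ}
    (hx : ∀ i, 0 ≤ x i) (hx0 : x ≠ 0) (i : Fin n) : 0 < B.mulVec x i := by
  obtain ⟨j, hj⟩ := Function.ne_iff.1 hx0
  exact Finset.sum_pos' (fun l _ => mul_nonneg (hB i l).le (hx l))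
    ⟨j, Finset.mem_univ _, mul_pos (hB i j) ((hx j).lt_of_ne' hj)⟩

theorem pow_mulVec_of_eigenvector {R : Type*} [CommRing R] {A : Matrix (Fin n) (Fin n) R}
    {x : Fin n → R} {r : R} (h : A.mulVec x = r • x) (k : ℕ) :
    (A ^ k).mulVec x = r ^ k • x := by
  induction k with
  | zero => simp
  | succ k ih =>
    rw [pow_succ', ← Matrix.mulVec_mulVec, ih, Matrix.mulVec_smul, h, smul_smul, pow_succ]

/-- If `A x - ρ x` were nonzero, the positive matrix `A ^ m` would make it positive everywhere, so
the positive vector `A ^ m x` would violate `exists_mulVec_le_perronRoot_mul`. -/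
theorem mulVec_eq_of_perronRoot_mul_le [NeZero n] {A : Matrix (Fin n) (Fin n) ℝ}
    (hA : A.IsPrimitive) {x : Fin n → ℝ} (hx : ∀ i, 0 ≤ x i)
    (h : ∀ i, perronRoot A * x i ≤ A.mulVec x i) : A.mulVec x = perronRoot A • x := by
  obtain ⟨m, hm, hB⟩ := hA.exists_pos_pow
  by_contra hne
  have hx0 : x ≠ 0 := by rintro rfl; simp at hne
  obtain ⟨i, hi⟩ := exists_mulVec_le_perronRoot_mul hA.nonneg (mulVec_pos_of_pos hB hx hx0)
  have := mulVec_pos_of_pos hB (x := A.mulVec x - perronRoot A • x)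
    (fun i => sub_nonneg.2 (h i)) (sub_ne_zero.2 hne) i
  rw [Matrix.mulVec_sub, Matrix.mulVec_smul, Matrix.mulVec_mulVec, ← pow_succ, pow_succ',
    ← Matrix.mulVec_mulVec] at this
  simp only [Pi.sub_apply, Pi.smul_apply, smul_eq_mul] at this
  linarith

theorem pos_of_mulVec_eq {A : Matrix (Fin n) (Fin n) ℝ}
    (hA : A.IsPrimitive) {x : Fin n → ℝ} (hx : ∀ i, 0 ≤ x i) (hx0 : x ≠ 0) {r : ℝ} (hr : 0 ≤ r)
    (h : A.mulVec x = r • x) : ∀ i, 0 < r ∧ 0 < x i := by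
  intro i
  obtain ⟨m, hm, hB⟩ := hA.exists_pos_pow
  have := mulVec_pos_of_pos hB hx hx0 i
  rw [pow_mulVec_of_eigenvector h, Pi.smul_apply, smul_eq_mul] at this
  refine ⟨hr.lt_of_ne' ?_, (hx i).lt_of_ne' ?_⟩
  · rintro rfl
    simp [hm.ne'] at this
  · intro h0
    simp [h0] at this

/-- The triangle inequality gives `ρ |z| ≤ A |z|`, which primitivity upgrades to equality. -/
theorem mulVec_norm_eq [NeZero n] {A : Matrix (Fin n) (Fin n) ℝ} (hA : A.IsPrimitive)
    {z : Fin n → ℂ} {μ : ℂ} (hz : (toComplex A).mulVec z = μ • z) (hμ : ‖μ‖ = perronRoot A) :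
    A.mulVec (fun j => ‖z j‖) = perronRoot A • fun j => ‖z j‖ := by
  refine mulVec_eq_of_perronRoot_mul_le hA (fun i => norm_nonneg _) fun i => ?_
  rw [← hμ, ← norm_mul]
  simpa [hz] using norm_toComplex_mulVec_le hA.nonneg z i

theorem norm_pos_of_eigenvector [NeZero n] {A : Matrix (Fin n) (Fin n) ℝ} (hA : A.IsPrimitive)
    {z : Fin n → ℂ} {μ : ℂ} (hz : (toComplex A).mulVec z = μ • z) (hz0 : z ≠ 0)
    (hμ : ‖μ‖ = perronRoot A) (i : Fin n) : 0 < ‖z i‖ := by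
  refine (pos_of_mulVec_eq hA (fun i => norm_nonneg _) ?_ (perronRoot_nonneg A)
    (mulVec_norm_eq hA hz hμ) i).2
  obtain ⟨j, hj⟩ := Function.ne_iff.1 hz0
  exact fun h => hj (by simpa using congrFun h j)

/-- Equality holds in the triangle inequality for a row of the positive matrix `A ^ m`, so all
entries of `z` share one argument. Then `z` is a multiple of `|z|`, whose eigenvalue is `ρ`. -/
theorem eq_perronRoot_of_norm_eq [NeZero n] {A : Matrix (Fin n) (Fin n) ℝ} (hA : A.IsPrimitive)
    {μ : ℂ} (hμ : μ ∈ spectrum ℂ (toComplex A)) (hn : ‖μ‖ = perronRoot A) :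
    μ = perronRoot A := by
  obtain ⟨z, hz0, hz⟩ := exists_eigenvector hμ
  have habs := mulVec_norm_eq hA hz hn
  have hpos := norm_pos_of_eigenvector hA hz hz0 hn
  obtain ⟨m, hm, hB⟩ := hA.exists_pos_pow
  have h1 : ((toComplex (A ^ m)).mulVec z) 0 = μ ^ m * z 0 := by
    rw [toComplex_pow, pow_mulVec_of_eigenvector hz]; rfl
  have h2 : ((A ^ m).mulVec fun j => ‖z j‖) 0 = perronRoot A ^ m * ‖z 0‖ := by
    rw [pow_mulVec_of_eigenvector habs]; rfl
  have hρ : 0 < perronRoot A := (pos_of_mulVec_eq hA (fun i => (hpos i).le)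
    (fun h => (hpos 0).ne' (congrFun h 0)) (perronRoot_nonneg A) habs 0).1
  -- `c` rotates the entry `(A ^ m z)_0` onto the positive real axis.
  obtain ⟨c, hc, hcz⟩ : ∃ c : ℂ, ‖c‖ = 1 ∧ c * (μ ^ m * z 0) = (‖μ ^ m * z 0‖ : ℝ) := by
    have h0 : μ ^ m * z 0 ≠ 0 := by
      rw [← norm_pos_iff, norm_mul, norm_pow, hn]
      exact mul_pos (pow_pos hρ m) (hpos 0)
    have h0' : ((‖μ ^ m * z 0‖ : ℝ) : ℂ) ≠ 0 := by simpa using h0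
    refine ⟨‖μ ^ m * z 0‖ / (μ ^ m * z 0), ?_, div_mul_cancel₀ _ h0⟩
    rw [norm_div, Complex.norm_real, norm_norm, div_self (norm_ne_zero_iff.2 h0)]
  have hsum : ∑ j, (A ^ m) 0 j * (‖z j‖ - (c * z j).re) = 0 := by
    have h3 : (∑ j, (A ^ m) 0 j * (c * z j).re : ℝ) = perronRoot A ^ m * ‖z 0‖ := by
      have := congrArg Complex.re hcz
      rw [← h1, Complex.ofReal_re, h1, norm_mul, norm_pow, hn] at this
      have h4 : (toComplex (A ^ m)).mulVec z 0 = ∑ j, (((A ^ m) 0 j : ℝ) : ℂ) * z j := rfl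
      rw [← this, ← h1, h4, Finset.mul_sum, Complex.re_sum]
      refine Finset.sum_congr rfl fun j _ => ?_
      rw [mul_left_comm, Complex.re_ofReal_mul]
    have h4 : (∑ j, (A ^ m) 0 j * ‖z j‖ : ℝ) = perronRoot A ^ m * ‖z 0‖ := h2
    rw [Finset.sum_congr rfl fun j _ => mul_sub ((A ^ m) 0 j) ‖z j‖ (c * z j).re,
      Finset.sum_sub_distrib, h3, h4, sub_self]
  have hle : ∀ j, (c * z j).re ≤ ‖z j‖ := fun j => by
    simpa [hc] using Complex.re_le_norm (c * z j)
  -- Nonnegative gaps with positive weights sum to zero, so every gap vanishes.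
  have hterm : ∀ j, c * z j = (‖z j‖ : ℝ) := fun j => by
    have h4 := (Finset.sum_eq_zero_iff_of_nonneg fun j _ =>
      mul_nonneg (hB 0 j).le (sub_nonneg.2 (hle j))).1 hsum j (Finset.mem_univ j)
    have h5 : (c * z j).re = ‖c * z j‖ := by
      rw [norm_mul, hc, one_mul]
      linarith [(mul_eq_zero.1 h4).resolve_left (hB 0 j).ne']
    refine Complex.ext (by rw [h5, norm_mul, hc, one_mul, Complex.ofReal_re]) ?_
    rw [Complex.ofReal_im, (Complex.nonneg_iff.1 (Complex.re_eq_norm.1 h5)).2]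
  have h7 := congrFun (toComplex_mulVec_ofReal A fun j => ‖z j‖) 0
  have h8 : (fun j => ((‖z j‖ : ℝ) : ℂ)) = c • z := funext fun j => (hterm j).symm
  rw [h8, Matrix.mulVec_smul, hz, habs] at h7
  simp only [Pi.smul_apply, smul_eq_mul, Complex.ofReal_mul, ← hterm] at h7
  have h9 : c * z 0 ≠ 0 := by rw [hterm]; exact_mod_cast (hpos 0).ne'
  refine mul_right_cancel₀ h9 ?_
  rw [← h7]; ring

theorem exists_perronVector [NeZero n] {A : Matrix (Fin n) (Fin n) ℝ} (hA : A.IsPrimitive) :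
    ∃ u, IsPerronVector A u := by
  obtain ⟨μ, hμ, hn, -⟩ := exists_norm_eq_perronRoot A
  obtain ⟨z, hz0, hz⟩ := exists_eigenvector hμ
  have hpos := norm_pos_of_eigenvector hA hz hz0 hn
  have hs : 0 < ∑ j, ‖z j‖ := Finset.sum_pos (fun j _ => hpos j) Finset.univ_nonempty
  refine ⟨(∑ j, ‖z j‖)⁻¹ • fun j => ‖z j‖, fun i => mul_pos (inv_pos.2 hs) (hpos i), ?_, ?_⟩
  · rw [Matrix.mulVec_smul, mulVec_norm_eq hA hz hn, smul_comm]
  · simp only [Pi.smul_apply, smul_eq_mul, ← Finset.mul_sum]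
    exact inv_mul_cancel₀ hs.ne'

theorem perronRoot_pos [NeZero n] {A : Matrix (Fin n) (Fin n) ℝ} (hA : A.IsPrimitive) :
    0 < perronRoot A := by
  obtain ⟨u, hu, hAu, -⟩ := exists_perronVector hA
  exact (pos_of_mulVec_eq hA (fun i => (hu i).le) (fun h => (hu 0).ne' (congrFun h 0))
    (perronRoot_nonneg A) hAu 0).1

theorem isPrimitive_transpose {A : Matrix (Fin n) (Fin n) ℝ} (hA : A.IsPrimitive) :
    A.transpose.IsPrimitive := by
  obtain ⟨m, hm, hB⟩ := hA.exists_pos_pow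
  exact ⟨fun i j => hA.nonneg j i, m, hm, fun i j => by
    rw [← Matrix.transpose_pow]; exact hB j i⟩

/-- Evaluating `w ⬝ᵥ A u` on either side shows that `A` and its transpose have the same Perron root,
as `w ⬝ᵥ u > 0`. -/
theorem exists_left_perronVector [NeZero n] {A : Matrix (Fin n) (Fin n) ℝ} (hA : A.IsPrimitive)
    {u : Fin n → ℝ} (hu : IsPerronVector A u) :
    ∃ w : Fin n → ℝ, (∀ i, 0 < w i) ∧ Matrix.vecMul w A = perronRoot A • w ∧ w ⬝ᵥ u = 1 := by
  obtain ⟨hu, hAu, -⟩ := hu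
  obtain ⟨w, hw, hAw, -⟩ := exists_perronVector (isPrimitive_transpose hA)
  rw [Matrix.mulVec_transpose] at hAw
  have hpos : 0 < w ⬝ᵥ u :=
    Finset.sum_pos (fun j _ => mul_pos (hw j) (hu j)) Finset.univ_nonempty
  have h := Matrix.dotProduct_mulVec w A u
  rw [hAu, hAw, dotProduct_smul, smul_dotProduct, smul_eq_mul, smul_eq_mul] at h
  rw [← mul_right_cancel₀ hpos.ne' h] at hAw
  refine ⟨(w ⬝ᵥ u)⁻¹ • w, fun i => mul_pos (inv_pos.2 hpos) (hw i), ?_, ?_⟩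
  · rw [Matrix.smul_vecMul, hAw, smul_comm]
  · rw [smul_dotProduct, smul_eq_mul, inv_mul_cancel₀ hpos.ne']

/-- The difference of the two sides vanishes at coordinate `0`, but an eigenvector for `ρ` has no
zero entry. -/
theorem eigenspace_perronRoot [NeZero n] {A : Matrix (Fin n) (Fin n) ℝ} (hA : A.IsPrimitive)
    {u : Fin n → ℝ} (hu : IsPerronVector A u) {v : Fin n → ℂ}
    (hv : (toComplex A).mulVec v = (perronRoot A : ℂ) • v) :
    v = (v 0 / (u 0 : ℂ)) • fun i => (u i : ℂ) := by
  by_contra hne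
  have hu' : (toComplex A).mulVec (fun i => (u i : ℂ)) =
      (perronRoot A : ℂ) • fun i => (u i : ℂ) := by
    rw [toComplex_mulVec_ofReal, hu.2.1]
    ext i
    simp
  have h := norm_pos_of_eigenvector hA (z := v - (v 0 / (u 0 : ℂ)) • fun i => (u i : ℂ))
    (μ := (perronRoot A : ℂ))
    (by rw [Matrix.mulVec_sub, Matrix.mulVec_smul, hv, hu', smul_sub, smul_comm])
    (sub_ne_zero.2 hne)
    (by rw [Complex.norm_real, Real.norm_of_nonneg (perronRoot_nonneg A)]) 0
  have h0 : (u 0 : ℂ) ≠ 0 := by exact_mod_cast (hu.1 0).ne'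
  simp [h0] at h

theorem eq_smul_of_mulVec_eq [NeZero n] {A : Matrix (Fin n) (Fin n) ℝ} (hA : A.IsPrimitive)
    {u : Fin n → ℝ} (hu : IsPerronVector A u) {x : Fin n → ℝ}
    (hx : A.mulVec x = perronRoot A • x) : x = (x 0 / u 0) • u := by
  have h := eigenspace_perronRoot hA hu (v := fun i => (x i : ℂ))
    (by rw [toComplex_mulVec_ofReal, hx]; ext i; simp)
  ext i
  have := congrFun h i
  simp only [Pi.smul_apply, smul_eq_mul] at this ⊢
  exact_mod_cast this

/-! ### Algebraic simplicity of the Perron root -/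

theorem dotProduct_toComplex_mulVec {A : Matrix (Fin n) (Fin n) ℝ} {w : Fin n → ℝ} {r : ℝ}
    (hw : Matrix.vecMul w A = r • w) (v : Fin n → ℂ) :
    (fun i => (w i : ℂ)) ⬝ᵥ (toComplex A).mulVec v = r * ((fun i => (w i : ℂ)) ⬝ᵥ v) := by
  have h : Matrix.vecMul (fun i => (w i : ℂ)) (toComplex A) = (r : ℂ) • fun i => (w i : ℂ) := by
    ext i
    have := congrArg Complex.ofReal (congrFun hw i)
    simpa [toComplex, Matrix.vecMul, dotProduct] using this
  rw [Matrix.dotProduct_mulVec, h, smul_dotProduct, smul_eq_mul]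

/-- Used twice: `μ = r` rules out a Jordan block at `ρ`, and `μ ≠ r` shows that `w` annihilates the
other generalized eigenspaces. -/
theorem dotProduct_pow_sub_apply {A : Matrix (Fin n) (Fin n) ℝ} {w : Fin n → ℝ} {r : ℝ}
    (hw : Matrix.vecMul w A = r • w) (μ : ℂ) (k : ℕ) (v : Fin n → ℂ) :
    (fun i => (w i : ℂ)) ⬝ᵥ
      (((Matrix.toLin' (toComplex A) - μ • 1 : Module.End ℂ (Fin n → ℂ)) ^ k) v) =
      (r - μ) ^ k * ((fun i => (w i : ℂ)) ⬝ᵥ v) := by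
  induction k with
  | zero => simp
  | succ k ih =>
    rw [pow_succ', Module.End.mul_apply, LinearMap.sub_apply, dotProduct_sub,
      Matrix.toLin'_apply, dotProduct_toComplex_mulVec hw, LinearMap.smul_apply,
      Module.End.one_apply, dotProduct_smul, ih, smul_eq_mul]
    ring

theorem maxGenEigenspace_perronRoot [NeZero n] {A : Matrix (Fin n) (Fin n) ℝ}
    (hA : A.IsPrimitive) {u : Fin n → ℝ} (hu : IsPerronVector A u) {v : Fin n → ℂ}
    (hv : v ∈ Module.End.maxGenEigenspace (Matrix.toLin' (toComplex A)) (perronRoot A : ℂ)) :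
    v = (v 0 / (u 0 : ℂ)) • fun i => (u i : ℂ) := by
  obtain ⟨w, hw, hwA, hwu⟩ := exists_left_perronVector hA hu
  rw [Module.End.mem_maxGenEigenspace] at hv
  obtain ⟨k, hk⟩ := hv
  set N : Module.End ℂ (Fin n → ℂ) := Matrix.toLin' (toComplex A) - (perronRoot A : ℂ) • 1 with hN
  have hNx : ∀ x, N x = (toComplex A).mulVec x - (perronRoot A : ℂ) • x := fun x => by
    simp [hN]
  -- Here `N x` is a multiple of `u`, and `w` kills the range of `N` while `w ⬝ᵥ u = 1`, so the
  -- multiple is zero.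
  have key : ∀ x, N (N x) = 0 → N x = 0 := fun x hx => by
    rw [hNx (N x), sub_eq_zero] at hx
    have h1 := eigenspace_perronRoot hA hu hx
    have h2 := dotProduct_pow_sub_apply hwA (perronRoot A : ℂ) 1 x
    rw [pow_one, pow_one, sub_self, zero_mul, ← hN, h1, dotProduct_smul] at h2
    have h3 : (fun i => (w i : ℂ)) ⬝ᵥ (fun i => (u i : ℂ)) = 1 := by
      have := congrArg Complex.ofReal hwu
      simpa [dotProduct] using this
    rw [h3, smul_eq_mul, mul_one] at h2
    rw [h1, h2, zero_smul]
  have h1 : ∀ k, (N ^ k) v = 0 → N v = 0 := by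
    intro k
    induction k with
    | zero => intro h; simp at h; simp [h]
    | succ k ih =>
      cases k with
      | zero => intro h; simpa using h
      | succ k =>
        intro h
        refine ih ?_
        rw [pow_succ', Module.End.mul_apply]
        refine key _ ?_
        rwa [pow_succ', pow_succ', Module.End.mul_apply, Module.End.mul_apply] at h
  have h2 := h1 k hk
  rw [hNx, sub_eq_zero] at h2
  exact eigenspace_perronRoot hA hu h2

/-- The algebraic multiplicity is the dimension of the generalized eigenspace, here at most `1`, so
erasing one copy leaves none. -/
theorem perronRoot_notMem_otherEigenvalues [NeZero n] {A : Matrix (Fin n) (Fin n) ℝ}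
    (hA : A.IsPrimitive) : (perronRoot A : ℂ) ∉ otherEigenvalues A := by
  classical
  obtain ⟨u, hu⟩ := exists_perronVector hA
  have h1 : Module.finrank ℂ
      (Module.End.maxGenEigenspace (Matrix.toLin' (toComplex A)) (perronRoot A : ℂ)) ≤ 1 := by
    have hu0 : (fun i => (u i : ℂ)) ≠ 0 := fun h =>
      (hu.1 0).ne' (Complex.ofReal_eq_zero.1 (congrFun h 0))
    have : Module.End.maxGenEigenspace (Matrix.toLin' (toComplex A)) (perronRoot A : ℂ) ≤
        Submodule.span ℂ {fun i => (u i : ℂ)} := fun v hv =>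
      Submodule.mem_span_singleton.2 ⟨_, (maxGenEigenspace_perronRoot hA hu hv).symm⟩
    exact (Submodule.finrank_mono this).trans (finrank_span_singleton hu0).le
  rw [LinearMap.finrank_maxGenEigenspace_eq, Matrix.charpoly_toLin',
    ← Polynomial.count_roots] at h1
  rw [otherEigenvalues, ← Multiset.count_eq_zero]
  have h2 := Multiset.count_erase_self (perronRoot A : ℂ) (toComplex A).charpoly.roots
  convert Nat.sub_eq_zero_of_le h1 using 1

theorem mem_otherEigenvalues [NeZero n] {A : Matrix (Fin n) (Fin n) ℝ} (hA : A.IsPrimitive)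
    {μ : ℂ} : μ ∈ otherEigenvalues A ↔ μ ∈ spectrum ℂ (toComplex A) ∧ μ ≠ perronRoot A := by
  classical
  rw [Matrix.mem_spectrum_iff_isRoot_charpoly,
    ← Polynomial.mem_roots (Matrix.charpoly_monic _).ne_zero]
  refine ⟨fun h => ⟨Multiset.mem_of_mem_erase h, ?_⟩, fun h => (Multiset.mem_erase_of_ne h.2).2 h.1⟩
  rintro rfl
  exact perronRoot_notMem_otherEigenvalues hA h

/-! ### Spectral gap and asymptotics of the powers -/

theorem norm_le_secondModulus {A : Matrix (Fin n) (Fin n) ℝ} {μ : ℂ}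
    (hμ : μ ∈ otherEigenvalues A) : ‖μ‖ ≤ secondModulus A :=
  NNReal.coe_le_coe.2 (Multiset.le_sup (Multiset.mem_map_of_mem (fun μ => ‖μ‖₊) hμ))

theorem secondModulus_nonneg (A : Matrix (Fin n) (Fin n) ℝ) : 0 ≤ secondModulus A :=
  NNReal.coe_nonneg _

theorem secondModulus_lt_perronRoot [NeZero n] {A : Matrix (Fin n) (Fin n) ℝ}
    (hA : A.IsPrimitive) : secondModulus A < perronRoot A := by
  -- `0 < r` covers the empty multiset, whose supremum is `0`; this is the case `n = 1`.
  have hsup : ∀ (s : Multiset NNReal) (r : NNReal), 0 < r → (∀ x ∈ s, x < r) → s.sup < r := by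
    intro s r hr
    induction s using Multiset.induction_on with
    | empty => intro _; simpa using hr
    | cons a s ih =>
      intro h
      rw [Multiset.sup_cons]
      exact max_lt (h a (Multiset.mem_cons_self a s))
        (ih fun x hx => h x (Multiset.mem_cons_of_mem hx))
  have h := hsup ((otherEigenvalues A).map fun μ => ‖μ‖₊)
    ⟨perronRoot A, perronRoot_nonneg A⟩ (perronRoot_pos hA) fun x hx => by
      obtain ⟨μ, hμ, rfl⟩ := Multiset.mem_map.1 hx
      obtain ⟨hμ1, hμ2⟩ := (mem_otherEigenvalues hA).1 hμ
      exact (norm_le_perronRoot A hμ1).lt_of_ne fun h => hμ2 (eq_perronRoot_of_norm_eq hA hμ1 h)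
  exact NNReal.coe_lt_coe.2 h

theorem maxGenEigenspaceIndex_le_secondJordanSize {A : Matrix (Fin n) (Fin n) ℝ} {μ : ℂ}
    (hμ : μ ∈ otherEigenvalues A) (h : ‖μ‖ = secondModulus A) :
    Module.End.maxGenEigenspaceIndex (Matrix.toLin' (toComplex A)) μ ≤ secondJordanSize A := by
  classical
  refine Multiset.le_sup (Multiset.mem_map.2 ⟨μ, ?_, rfl⟩)
  exact Multiset.mem_filter.2 ⟨hμ, h⟩

/-- At modulus `|λ₂|` the block size is at most `s`; at smaller modulus the exponential gap absorbs
any polynomial factor. -/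
theorem isBigO_pow_mulVec_of_mem_otherEigenvalues {A : Matrix (Fin n) (Fin n) ℝ} {μ : ℂ}
    (hμ : μ ∈ otherEigenvalues A) {v : Fin n → ℂ}
    (hv : v ∈ Module.End.maxGenEigenspace (Matrix.toLin' (toComplex A)) μ) :
    (fun k : ℕ => (toComplex A ^ k).mulVec v) =O[atTop]
      fun k : ℕ => (k : ℝ) ^ (secondJordanSize A - 1) * secondModulus A ^ k := by
  have h1 := isBigO_pow_apply_of_mem_maxGenEigenspace _ μ hv
  simp only [toLin'_pow_apply] at h1
  refine h1.trans ?_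
  have hmono : ∀ {a b : ℕ}, a ≤ b → (fun k : ℕ => (k : ℝ) ^ a * secondModulus A ^ k) =O[atTop]
      fun k : ℕ => (k : ℝ) ^ b * secondModulus A ^ k := by
    intro a b hab
    refine IsBigO.of_bound 1 ?_
    filter_upwards [eventually_ge_atTop 1] with k hk
    have hk' : (1 : ℝ) ≤ k := by exact_mod_cast hk
    rw [one_mul, norm_mul, norm_mul]
    refine mul_le_mul_of_nonneg_right ?_ (norm_nonneg _)
    rw [norm_pow, norm_pow, Real.norm_of_nonneg (Nat.cast_nonneg k)]
    exact pow_le_pow_right₀ hk' hab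
  rcases (norm_le_secondModulus hμ).eq_or_lt with h | h
  · rw [h]
    exact hmono (Nat.sub_le_sub_right (maxGenEigenspaceIndex_le_secondJordanSize hμ h) 1)
  · have h2 : ‖(‖μ‖ : ℝ)‖ < secondModulus A := by rwa [norm_norm]
    refine (isLittleO_pow_const_mul_const_pow_const_pow_of_norm_lt _ h2).isBigO.trans ?_
    simpa using hmono (Nat.zero_le (secondJordanSize A - 1))

/-- The claim is additive in `v`, so it suffices to check generalized eigenspaces: at `ρ` the
difference is zero, elsewhere `w ⬝ᵥ v = 0`. -/
theorem isBigO_toComplex_pow_mulVec_sub [NeZero n] {A : Matrix (Fin n) (Fin n) ℝ}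
    (hA : A.IsPrimitive) {u w : Fin n → ℝ} (hu : IsPerronVector A u)
    (hw : Matrix.vecMul w A = perronRoot A • w) (hwu : w ⬝ᵥ u = 1) (v : Fin n → ℂ) :
    (fun k : ℕ => (toComplex A ^ k).mulVec v -
        ((perronRoot A : ℂ) ^ k * ((fun i => (w i : ℂ)) ⬝ᵥ v)) • fun i => (u i : ℂ)) =O[atTop]
      fun k : ℕ => (k : ℝ) ^ (secondJordanSize A - 1) * secondModulus A ^ k := by
  have hv : v ∈ ⨆ μ, Module.End.maxGenEigenspace (Matrix.toLin' (toComplex A)) μ := by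
    rw [Module.End.iSup_maxGenEigenspace_eq_top]; trivial
  induction hv using Submodule.iSup_induction' with
  | mem μ v hv =>
    rcases eq_or_ne v 0 with rfl | hv0
    · simpa using isBigO_zero _ _
    rcases eq_or_ne μ (perronRoot A) with rfl | hμ
    · have h1 := maxGenEigenspace_perronRoot hA hu hv
      have h3 : (fun i => (w i : ℂ)) ⬝ᵥ (fun i => (u i : ℂ)) = 1 := by
        have := congrArg Complex.ofReal hwu
        simpa [dotProduct] using this
      have hu' : (toComplex A).mulVec (fun i => (u i : ℂ)) =
          (perronRoot A : ℂ) • fun i => (u i : ℂ) := by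
        rw [toComplex_mulVec_ofReal, hu.2.1]
        ext i
        simp
      refine (isBigO_zero _ _).congr_left fun k => ?_
      rw [h1, Matrix.mulVec_smul, pow_mulVec_of_eigenvector hu', dotProduct_smul, h3, smul_smul,
        smul_eq_mul, mul_one, mul_comm, sub_self]
    · have h0 : (fun i => (w i : ℂ)) ⬝ᵥ v = 0 := by
        obtain ⟨k, hk⟩ := (Module.End.mem_maxGenEigenspace _ _ _).1 hv
        have h := dotProduct_pow_sub_apply hw μ k v
        rw [hk, dotProduct_zero] at h
        exact (mul_eq_zero.1 h.symm).resolve_left (pow_ne_zero k (sub_ne_zero.2 hμ.symm))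
      simp only [h0, mul_zero, zero_smul, sub_zero]
      exact isBigO_pow_mulVec_of_mem_otherEigenvalues
        ((mem_otherEigenvalues hA).2 ⟨mem_spectrum_of_mem_maxGenEigenspace hv hv0, hμ⟩) hv
  | zero => simpa using isBigO_zero _ _
  | add x y _ _ hx hy =>
    refine (hx.add hy).congr_left fun k => ?_
    rw [Matrix.mulVec_add, dotProduct_add, mul_add, add_smul]
    abel

/-- The rate `k ^ max (s - 1) 0 * |λ₂ / λ₁| ^ k` of convergence. -/
noncomputable def rate (A : Matrix (Fin n) (Fin n) ℝ) (k : ℕ) : ℝ :=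
  (k : ℝ) ^ (secondJordanSize A - 1) * (secondModulus A / perronRoot A) ^ k

theorem isBigO_inv_pow_mul_pow_mulVec_sub [NeZero n] {A : Matrix (Fin n) (Fin n) ℝ}
    (hA : A.IsPrimitive) {u w : Fin n → ℝ} (hu : IsPerronVector A u)
    (hw : Matrix.vecMul w A = perronRoot A • w) (hwu : w ⬝ᵥ u = 1) (x : Fin n → ℝ) :
    (fun k : ℕ => (perronRoot A ^ k)⁻¹ • (A ^ k).mulVec x - (w ⬝ᵥ x) • u) =O[atTop] rate A := by
  have hρ := perronRoot_pos hA
  refine isBigO_pi.2 fun i => ?_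
  have h1 := isBigO_pi.1 (isBigO_toComplex_pow_mulVec_sub hA hu hw hwu fun i => (x i : ℂ)) i
  have h2 := (isBigO_refl (fun k : ℕ => ((perronRoot A : ℝ) ^ k)⁻¹) atTop).mul (h1.norm_left)
  refine isBigO_norm_left.1 (h2.congr (fun k => ?_) fun k => ?_)
  · have h3 : (((toComplex A ^ k).mulVec fun i => (x i : ℂ)) - ((perronRoot A : ℂ) ^ k *
        ((fun i => (w i : ℂ)) ⬝ᵥ fun i => (x i : ℂ))) • fun i => (u i : ℂ)) i =
        (((A ^ k).mulVec x i - perronRoot A ^ k * (w ⬝ᵥ x) * u i : ℝ) : ℂ) := by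
      rw [← toComplex_pow, toComplex_mulVec_ofReal]
      simp [dotProduct]
    have h4 : (perronRoot A ^ k)⁻¹ = ‖(perronRoot A ^ k)⁻¹‖ :=
      (Real.norm_of_nonneg (inv_nonneg.2 (pow_pos hρ k).le)).symm
    rw [h3, Complex.norm_real]
    nth_rw 1 [h4]
    rw [← norm_mul]
    congr 1
    simp only [Pi.sub_apply, Pi.smul_apply, smul_eq_mul]
    have := (pow_pos hρ k).ne'
    field_simp
  · rw [rate, div_pow]
    ring

theorem tendsto_rate [NeZero n] {A : Matrix (Fin n) (Fin n) ℝ} (hA : A.IsPrimitive) :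
    Tendsto (rate A) atTop (nhds 0) :=
  tendsto_pow_const_mul_const_pow_of_lt_one _
    (div_nonneg (secondModulus_nonneg A) (perronRoot_nonneg A))
    ((div_lt_one (perronRoot_pos hA)).2 (secondModulus_lt_perronRoot hA))

/-- In the coordinates `U⁻¹ v` the map `A - μ` is diagonal, and a diagonal map has the same kernel
as each of its positive powers. -/
theorem secondJordanSize_le_one_of_isDiagonalizable {A : Matrix (Fin n) (Fin n) ℝ}
    (hA : IsDiagonalizable A) : secondJordanSize A ≤ 1 := by
  obtain ⟨U, d, hU, hAU⟩ := hA
  refine Multiset.sup_le.2 fun m hm => ?_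
  obtain ⟨μ, -, rfl⟩ := Multiset.mem_map.1 hm
  have hV : U * U⁻¹ = 1 := Matrix.mul_nonsing_inv U hU
  have hV' : U⁻¹ * U = 1 := Matrix.nonsing_inv_mul U hU
  have hpow : ∀ (k : ℕ) (v : Fin n → ℂ),
      ((Matrix.toLin' (toComplex A) - μ • 1 : Module.End ℂ (Fin n → ℂ)) ^ k) v =
        U.mulVec fun i => (d i - μ) ^ k * U⁻¹.mulVec v i := by
    intro k v
    induction k with
    | zero => simp [hV]
    | succ k ih =>
      rw [pow_succ', Module.End.mul_apply, ih, LinearMap.sub_apply, Matrix.toLin'_apply, hAU,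
        LinearMap.smul_apply, Module.End.one_apply, Matrix.mulVec_mulVec, Matrix.mul_assoc, hV',
        mul_one, ← Matrix.mulVec_mulVec, ← Matrix.mulVec_smul, ← Matrix.mulVec_sub]
      congr 1
      ext i
      simp only [Pi.sub_apply, Matrix.mulVec_diagonal, Pi.smul_apply, smul_eq_mul]
      ring
  refine Nat.sInf_le fun m hm => ?_
  refine le_antisymm (OrderHom.monotone _ hm) fun v hv => ?_
  change v ∈ Module.End.genEigenspace _ μ (m : ℕ) at hv
  change v ∈ Module.End.genEigenspace _ μ (1 : ℕ)
  rw [Module.End.mem_genEigenspace_nat, LinearMap.mem_ker, hpow] at hv ⊢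
  have hz : (fun i => (d i - μ) ^ m * U⁻¹.mulVec v i) = 0 := by
    have := congrArg U⁻¹.mulVec hv
    rwa [Matrix.mulVec_mulVec, hV', Matrix.one_mulVec, Matrix.mulVec_zero] at this
  have hz' : (fun i => (d i - μ) ^ 1 * U⁻¹.mulVec v i) = 0 := by
    ext i
    rcases mul_eq_zero.1 (congrFun hz i) with h | h
    · simp [eq_zero_of_pow_eq_zero h]
    · simp [h]
  rw [hz', Matrix.mulVec_zero]

/-! ### Closed form of the algorithm -/

/-- The row sums `A ^ k 1` of the powers of `A`. -/
def powOnes (A : Matrix (Fin n) (Fin n) ℝ) (k : ℕ) : Fin n → ℝ :=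
  (A ^ k).mulVec fun _ => 1

theorem powOnes_zero (A : Matrix (Fin n) (Fin n) ℝ) : powOnes A 0 = fun _ => 1 := by
  simp [powOnes]

theorem powOnes_succ (A : Matrix (Fin n) (Fin n) ℝ) (k : ℕ) :
    powOnes A (k + 1) = A.mulVec (powOnes A k) := by
  rw [powOnes, powOnes, Matrix.mulVec_mulVec, pow_succ']

/-- A zero row of `A` would remain a zero row of `A ^ m`. -/
theorem mulVec_pos {A : Matrix (Fin n) (Fin n) ℝ} (hA : A.IsPrimitive) {x : Fin n → ℝ}
    (hx : ∀ i, 0 < x i) (i : Fin n) : 0 < A.mulVec x i := by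
  obtain ⟨m, hm, hB⟩ := hA.exists_pos_pow
  have hnn : ∀ j ∈ Finset.univ, 0 ≤ A i j * x j := fun j _ => mul_nonneg (hA.nonneg i j) (hx j).le
  refine (Finset.sum_nonneg hnn).lt_of_ne' fun h => ?_
  have h0 : ∀ j, A i j = 0 := fun j =>
    (mul_eq_zero.1 ((Finset.sum_eq_zero_iff_of_nonneg hnn).1 h j (Finset.mem_univ j))).resolve_right
      (hx j).ne'
  have h1 := hB i i
  obtain ⟨l, rfl⟩ := Nat.exists_eq_succ_of_ne_zero hm.ne'
  rw [pow_succ', Matrix.mul_apply] at h1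
  simp [h0] at h1

theorem powOnes_pos {A : Matrix (Fin n) (Fin n) ℝ} (hA : A.IsPrimitive) (k : ℕ) :
    ∀ i, 0 < powOnes A k i := by
  induction k with
  | zero => simp [powOnes_zero]
  | succ k ih => rw [powOnes_succ]; exact mulVec_pos hA ih

theorem rowSums_scaling (A : Matrix (Fin n) (Fin n) ℝ) (p : Fin n → ℝ) (i : Fin n) :
    rowSums (Matrix.of fun i j => A i j * p j / p i) i = A.mulVec p i / p i := by
  simp only [rowSums, Matrix.of_apply, Matrix.mulVec, dotProduct, Finset.sum_div]

/-- The scaling telescopes: multiplying `p = A ^ k 1` entrywise by the row sums `(A p)_i / p_i`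
gives `A p`. -/
theorem rowIterate_eq {A : Matrix (Fin n) (Fin n) ℝ} (hA : A.IsPrimitive) (k : ℕ) :
    rowIterate A k = Matrix.of fun i j => A i j * powOnes A k j / powOnes A k i := by
  induction k with
  | zero => ext i j; simp [rowIterate, powOnes_zero]
  | succ k ih =>
    ext i j
    have hi := (powOnes_pos hA k i).ne'
    have hj := (powOnes_pos hA k j).ne'
    have hi' := (powOnes_pos hA (k + 1) i).ne'
    simp only [rowIterate, ih, rowSums_scaling, ← powOnes_succ, Matrix.of_apply]
    field_simp

theorem rowSums_rowIterate {A : Matrix (Fin n) (Fin n) ℝ} (hA : A.IsPrimitive) (k : ℕ)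
    (i : Fin n) : rowSums (rowIterate A k) i = powOnes A (k + 1) i / powOnes A k i := by
  rw [rowIterate_eq hA, rowSums_scaling, powOnes_succ]

theorem vectorIterate_eq [NeZero n] {A : Matrix (Fin n) (Fin n) ℝ} (hA : A.IsPrimitive) (k : ℕ) :
    vectorIterate A k = (rowIterate A k, (powOnes A k 0)⁻¹ • powOnes A k) := by
  induction k with
  | zero =>
    refine Prod.ext rfl ?_
    ext i
    simp [vectorIterate, powOnes_zero]
  | succ k ih =>
    have h0 := (powOnes_pos hA k 0).ne'
    have h0' := (powOnes_pos hA (k + 1) 0).ne'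
    have hy : ∀ i, ((powOnes A k 0)⁻¹ • powOnes A k) i *
        (rowSums (rowIterate A k) i / rowSums (rowIterate A k) 0) =
        ((powOnes A (k + 1) 0)⁻¹ • powOnes A (k + 1)) i := by
      intro i
      have hi := (powOnes_pos hA k i).ne'
      simp only [rowSums_rowIterate hA, Pi.smul_apply, smul_eq_mul]
      field_simp
    simp only [vectorIterate, ih, hy]
    refine Prod.ext ?_ rfl
    rw [rowIterate_eq hA (k + 1)]
    ext i j
    have hi := (powOnes_pos hA (k + 1) i).ne'
    simp only [Matrix.hadamard_apply, Matrix.vecMulVec_apply, Matrix.of_apply, Pi.smul_apply,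
      smul_eq_mul]
    field_simp

theorem direction_smul (x : Fin n → ℝ) {c : ℝ} (hc : c ≠ 0) :
    direction (c • x) = direction x := by
  rw [direction, direction, WithLp.toLp_smul]
  exact Submodule.span_singleton_smul_eq hc.isUnit _

theorem direction_vectorIterate [NeZero n] {A : Matrix (Fin n) (Fin n) ℝ} (hA : A.IsPrimitive)
    (k : ℕ) : direction (vectorIterate A k).2 = direction (powOnes A k) := by
  rw [vectorIterate_eq hA]
  exact direction_smul _ (inv_ne_zero (powOnes_pos hA k 0).ne')

theorem exists_powerIterate_eq [NeZero n] {A : Matrix (Fin n) (Fin n) ℝ} (hA : A.IsPrimitive)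
    (k : ℕ) : ∃ c : ℝ, c ≠ 0 ∧ powerIterate A k = c • powOnes A k := by
  induction k with
  | zero => exact ⟨1, one_ne_zero, by simp [powerIterate, powOnes_zero]⟩
  | succ k ih =>
    obtain ⟨c, hc, h⟩ := ih
    have h1 : A.mulVec (powerIterate A k) = c • powOnes A (k + 1) := by
      rw [h, Matrix.mulVec_smul, powOnes_succ]
    refine ⟨‖WithLp.toLp 2 (A.mulVec (powerIterate A k))‖⁻¹ * c, mul_ne_zero ?_ hc, ?_⟩
    · refine inv_ne_zero (norm_ne_zero_iff.2 fun h2 => ?_)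
      rw [h1] at h2
      have h3 := congrArg (fun x : EuclideanSpace ℝ (Fin n) => x 0) h2
      simp [hc, (powOnes_pos hA (k + 1) 0).ne'] at h3
    · rw [powerIterate, mul_smul, h1]

/-! ### Distance between lines and the convergence rates -/

/-- The constant is a product: normalizing the vectors costs `2 / ‖y‖`, and passing from unit
vectors to their rank-one projections costs `2`. -/
theorem norm_starProjection_span_singleton_sub_le {E : Type*} [NormedAddCommGroup E]
    [InnerProductSpace ℝ E] {x y : E} (hx : x ≠ 0) (hy : y ≠ 0) :
    ‖(Submodule.span ℝ {x}).starProjection - (Submodule.span ℝ {y}).starProjection‖ ≤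
      4 / ‖y‖ * ‖x - y‖ := by
  have hproj : ∀ z : E, z ≠ 0 → ∀ v, (Submodule.span ℝ {z}).starProjection v =
      inner ℝ (‖z‖⁻¹ • z) v • (‖z‖⁻¹ • z) := fun z hz v => by
    rw [Submodule.starProjection_singleton, real_inner_smul_left, smul_smul]
    congr 1
    have := norm_ne_zero_iff.2 hz
    simp only [RCLike.ofReal_real_eq_id, id_eq]
    field_simp
  have hnorm : ∀ z : E, z ≠ 0 → ‖‖z‖⁻¹ • z‖ = 1 := fun z hz => norm_smul_inv_norm (𝕜 := ℝ) hz
  have hx' := norm_pos_iff.2 hx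
  have hy' := norm_pos_iff.2 hy
  have hab : ‖‖x‖⁻¹ • x - ‖y‖⁻¹ • y‖ ≤ 2 / ‖y‖ * ‖x - y‖ := by
    have h1 : ‖x‖⁻¹ • x - ‖y‖⁻¹ • y = ‖y‖⁻¹ • (x - y) + (‖x‖⁻¹ - ‖y‖⁻¹) • x := by module
    have h2 : ‖(‖x‖⁻¹ - ‖y‖⁻¹) • x‖ ≤ ‖y‖⁻¹ * ‖x - y‖ := by
      have h3 : (‖x‖⁻¹ - ‖y‖⁻¹) = ‖y‖⁻¹ * ((‖y‖ - ‖x‖) * ‖x‖⁻¹) := by field_simp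
      rw [h3, norm_smul, norm_mul, norm_mul, norm_inv, norm_inv, norm_norm, norm_norm, mul_assoc,
        mul_assoc, inv_mul_cancel₀ hx'.ne', mul_one]
      gcongr
      rw [norm_sub_rev x y]
      exact abs_norm_sub_norm_le y x
    rw [h1]
    refine (norm_add_le _ _).trans ?_
    rw [norm_smul, norm_inv, norm_norm]
    calc _ ≤ ‖y‖⁻¹ * ‖x - y‖ + ‖y‖⁻¹ * ‖x - y‖ := by gcongr
      _ = _ := by ring
  have hx2 := hproj x hx
  have hy2 := hproj y hy
  have ha1 := hnorm x hx
  have hb1 := hnorm y hy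
  set a := ‖x‖⁻¹ • x
  set b := ‖y‖⁻¹ • y
  clear_value a b
  have hop : ‖(Submodule.span ℝ {x}).starProjection - (Submodule.span ℝ {y}).starProjection‖ ≤
      2 * ‖a - b‖ := by
    refine ContinuousLinearMap.opNorm_le_bound _ (by positivity) fun z => ?_
    rw [sub_apply, hx2, hy2]
    have h1 : inner ℝ a z • a - inner ℝ b z • b =
        inner ℝ (a - b) z • a + inner ℝ b z • (a - b) := by
      rw [inner_sub_left]; module
    rw [h1]
    refine (norm_add_le _ _).trans ?_
    rw [norm_smul, norm_smul, ha1, mul_one]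
    have h2 := norm_inner_le_norm (𝕜 := ℝ) (a - b) z
    have h3 := norm_inner_le_norm (𝕜 := ℝ) b z
    rw [hb1, one_mul] at h3
    calc _ ≤ ‖a - b‖ * ‖z‖ + ‖z‖ * ‖a - b‖ := by gcongr
      _ = _ := by ring
  calc _ ≤ 2 * ‖a - b‖ := hop
    _ ≤ 2 * (2 / ‖y‖ * ‖x - y‖) := by gcongr
    _ = _ := by ring

theorem isBigO_subspaceDist_direction [NeZero n] {x : ℕ → Fin n → ℝ} {y : Fin n → ℝ}
    {g : ℕ → ℝ} (hx : ∀ k, x k ≠ 0) (hy : y ≠ 0) (h : (fun k => x k - y) =O[atTop] g) :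
    (fun k => subspaceDist (direction (x k)) (direction y)) =O[atTop] g := by
  have h1 : (fun k => WithLp.toLp 2 (x k) - WithLp.toLp 2 y) =O[atTop] g := by
    refine IsBigO.trans ?_ h
    exact (EuclideanSpace.equiv (Fin n) ℝ).symm.toContinuousLinearMap.isBigO_comp
      (fun k => x k - y) atTop
  refine (IsBigO.of_bound (4 / ‖WithLp.toLp 2 y‖) (Eventually.of_forall fun k => ?_)).trans h1
  rw [subspaceDist, norm_norm]
  exact norm_starProjection_span_singleton_sub_le (by simpa using hx k) (by simpa using hy)

theorem isBigO_subspaceDist_rate [NeZero n] {A : Matrix (Fin n) (Fin n) ℝ} (hA : A.IsPrimitive)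
    {u : Fin n → ℝ} (hu : IsPerronVector A u) :
    (fun k : ℕ => subspaceDist (direction (vectorIterate A k).2) (direction u)) =O[atTop]
      rate A := by
  obtain ⟨w, hw, hwA, hwu⟩ := exists_left_perronVector hA hu
  have hc : 0 < w ⬝ᵥ fun _ => (1 : ℝ) :=
    Finset.sum_pos (fun j _ => mul_pos (hw j) one_pos) Finset.univ_nonempty
  have hρ := perronRoot_pos hA
  have h := isBigO_subspaceDist_direction
    (x := fun k => (perronRoot A ^ k)⁻¹ • powOnes A k)
    (fun k h => (mul_pos (inv_pos.2 (pow_pos hρ k)) (powOnes_pos hA k 0)).ne' (congrFun h 0))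
    (fun h => (mul_pos hc (hu.1 0)).ne' (congrFun h 0))
    (isBigO_inv_pow_mul_pow_mulVec_sub hA hu hwA hwu fun _ => 1)
  refine h.congr_left fun k => ?_
  rw [direction_smul _ (inv_ne_zero (pow_pos hρ k).ne'), direction_smul _ hc.ne',
    direction_vectorIterate hA]

theorem isBigO_rowSums_rate [NeZero n] {A : Matrix (Fin n) (Fin n) ℝ} (hA : A.IsPrimitive)
    (i : Fin n) :
    (fun k : ℕ => rowSums (rowIterate A k) i - perronRoot A) =O[atTop] rate A := by
  obtain ⟨u, hu⟩ := exists_perronVector hA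
  obtain ⟨w, hw, hwA, hwu⟩ := exists_left_perronVector hA hu
  have hc : 0 < w ⬝ᵥ fun _ => (1 : ℝ) :=
    Finset.sum_pos (fun j _ => mul_pos (hw j) one_pos) Finset.univ_nonempty
  have hρ := perronRoot_pos hA
  set c := w ⬝ᵥ fun _ => (1 : ℝ)
  set x : ℕ → Fin n → ℝ := fun k => (perronRoot A ^ k)⁻¹ • powOnes A k with hx
  have he : (fun k => x k - c • u) =O[atTop] rate A :=
    isBigO_inv_pow_mul_pow_mulVec_sub hA hu hwA hwu fun _ => 1
  have hxi : Tendsto (fun k => x k i) atTop (nhds (c * u i)) := by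
    have := (isBigO_pi.1 he i).trans_tendsto (tendsto_rate hA)
    simpa using this.add_const (c * u i)
  -- The denominator tends to `c * u i > 0`, so its inverse stays bounded.
  have hinv : (fun k => (x k i)⁻¹) =O[atTop] fun _ => (1 : ℝ) :=
    (hxi.inv₀ (mul_pos hc (hu.1 i)).ne').isBigO_one ℝ
  have hnum : (fun k => (A.mulVec (x k) - perronRoot A • x k) i) =O[atTop] rate A := by
    have h1 := ((A.mulVecLin - perronRoot A • LinearMap.id).toContinuousLinearMap.isBigO_comp
      (fun k => x k - c • u) atTop).trans he
    refine (isBigO_pi.1 h1 i).congr_left fun k => ?_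
    -- `A - ρ` kills the limit `c • u`, so the numerator only sees the error `x k - c • u`.
    have h2 : (A.mulVecLin - perronRoot A • (LinearMap.id : (Fin n → ℝ) →ₗ[ℝ] _)) (c • u) = 0 := by
      simp [hu.2.1]
    rw [LinearMap.coe_toContinuousLinearMap', map_sub, h2, sub_zero]
    simp
  refine (hnum.mul hinv).congr (fun k => ?_) fun k => mul_one _
  have h0 := (powOnes_pos hA k i).ne'
  have h1 := (pow_pos hρ k).ne'
  rw [rowSums_rowIterate hA]
  simp only [hx, Matrix.mulVec_smul, ← powOnes_succ, Pi.sub_apply, Pi.smul_apply, smul_eq_mul]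
  field_simp

end MincIteration

theorem corollary2 (n : ℕ) [NeZero n] (A : Matrix (Fin n) (Fin n) ℝ) (hA : A.IsPrimitive) :
    -- the rate is below one
    0 < MincIteration.perronRoot A ∧
    MincIteration.secondModulus A < MincIteration.perronRoot A ∧
    -- every step is well defined, and both forms of the algorithm produce the same matrices
    (∀ k i, 0 < MincIteration.rowSums (MincIteration.rowIterate A k) i) ∧
    (∀ k, (MincIteration.vectorIterate A k).1 = MincIteration.rowIterate A k) ∧
    -- same direction, at every step, as the power method started at the all-ones vector
    (∀ k, MincIteration.direction (MincIteration.vectorIterate A k).2 =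
      MincIteration.direction (MincIteration.powerIterate A k)) ∧
    ∃ u : Fin n → ℝ,
      -- the Perron vector spans the eigenspace of the Perron root
      MincIteration.IsPerronVector A u ∧
      (∀ w : Fin n → ℝ, A.mulVec w = MincIteration.perronRoot A • w → ∃ c : ℝ, w = c • u) ∧
      -- the rate for an arbitrary primitive matrix
      ((fun k : ℕ => MincIteration.subspaceDist
          (MincIteration.direction (MincIteration.vectorIterate A k).2)
          (MincIteration.direction u)) =O[atTop]
        fun k : ℕ => (k : ℝ) ^ (MincIteration.secondJordanSize A - 1) *
          (MincIteration.secondModulus A / MincIteration.perronRoot A) ^ k) ∧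
      (∀ i, (fun k : ℕ => MincIteration.rowSums (MincIteration.rowIterate A k) i -
          MincIteration.perronRoot A) =O[atTop]
        fun k : ℕ => (k : ℝ) ^ (MincIteration.secondJordanSize A - 1) *
          (MincIteration.secondModulus A / MincIteration.perronRoot A) ^ k) ∧
      -- the rate for a diagonalizable primitive matrix
      (MincIteration.IsDiagonalizable A →
        ((fun k : ℕ => MincIteration.subspaceDist
            (MincIteration.direction (MincIteration.vectorIterate A k).2)
            (MincIteration.direction u)) =O[atTop]
          fun k : ℕ => (MincIteration.secondModulus A / MincIteration.perronRoot A) ^ k) ∧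
        (∀ i, (fun k : ℕ => MincIteration.rowSums (MincIteration.rowIterate A k) i -
            MincIteration.perronRoot A) =O[atTop]
          fun k : ℕ => (MincIteration.secondModulus A / MincIteration.perronRoot A) ^ k)) := by

  obtain ⟨u, hu⟩ := MincIteration.exists_perronVector hA
  refine ⟨MincIteration.perronRoot_pos hA, MincIteration.secondModulus_lt_perronRoot hA,
    fun k i => ?_, fun k => by rw [MincIteration.vectorIterate_eq hA], fun k => ?_, u, hu,
    fun x hx => ⟨_, MincIteration.eq_smul_of_mulVec_eq hA hu hx⟩,
    MincIteration.isBigO_subspaceDist_rate hA hu, MincIteration.isBigO_rowSums_rate hA,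
    fun hd => ?_⟩
  · rw [MincIteration.rowSums_rowIterate hA]
    exact div_pos (MincIteration.powOnes_pos hA _ i) (MincIteration.powOnes_pos hA k i)
  · obtain ⟨c, hc, h⟩ := MincIteration.exists_powerIterate_eq hA k
    rw [MincIteration.direction_vectorIterate hA, h, MincIteration.direction_smul _ hc]
  · have hrate : MincIteration.rate A =
        fun k : ℕ => (MincIteration.secondModulus A / MincIteration.perronRoot A) ^ k := by
      ext k
      rw [MincIteration.rate, Nat.sub_eq_zero_of_le
        (MincIteration.secondJordanSize_le_one_of_isDiagonalizable hd), pow_zero, one_mul]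
    rw [← hrate]
    exact ⟨MincIteration.isBigO_subspaceDist_rate hA hu, MincIteration.isBigO_rowSums_rate hA⟩
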